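/- For integers $n\ge 3$ and $1\le k<n/2$, the generalized Petersen graph $GP(n,k)$ has vertex set $\{u_i,v_i : 0\le i\le n-1\}$ and edge set $\{u_iu_{i+1},\,u_iv_i,\,v_iv_{i+k} : 0\le i\le n-1\}$, with indices taken modulo $n$. For a connected graph $G$, the distance between a vertex $w$ and an edge $xy$ is $d(w,xy)=\min\{d(w,x),d(w,y)\}$. A set $S$ of vertices is an edge metric generator of $G$ if for every two distinct edges $e_1,e_2$ of $G$ there is $w\in S$ with $d(w,e_1)\ne d(w,e_2)$. The edge metric dimension $\beta_E(G)$ is the smallest cardinality of an edge metric generator, and an edge metric basis is an edge metric generator of cardinality $\beta_E(G)$. Theorem. $$\beta_E(GP(n,2))=\begin{cases}3, & n=8 \text{ or } n\ge 10,\\ 4, & n\in\{5,6,7,9\}.\end{cases}$$ Moreover, for every $t\ge 4$: $\{u_0,v_3,v_{2t+3}\}$ is an edge metric basis of $GP(4t,2)$; $\{u_0,v_{2t-5},v_{2t-4}\}$ is an edge metric basis of $GP(4t+1,2)$; and $\{u_0,v_{2t-1},v_{2t}\}$ is an edge metric basis of both $GP(4t+2,2)$ and $GP(4t+3,2)$.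 -/

import Mathlib

/-- The generalized Petersen graph `GP(n, k)` (meaningful for `n ≥ 3`, `1 ≤ k < n / 2`).
The vertex `u_i` is `Sum.inl i` and the vertex `v_i` is `Sum.inr i`, with indices `i` modulo `n`;
the edges are `u_i u_{i+1}`, `u_i v_i` and `v_i v_{i+k}`. -/
def generalizedPetersen (n k : ℕ) : SimpleGraph (ZMod n ⊕ ZMod n) :=
  SimpleGraph.fromRel fun x y =>
    (∃ i : ZMod n, x = Sum.inl i ∧ y = Sum.inl (i + 1)) ∨
    (∃ i : ZMod n, x = Sum.inl i ∧ y = Sum.inr i) ∨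
    (∃ i : ZMod n, x = Sum.inr i ∧ y = Sum.inr (i + (k : ZMod n)))

/-- The distance `d(w, ab) = min (d(w, a), d(w, b))` from a vertex `w` to an edge `ab`. -/
noncomputable def SimpleGraph.vertexEdgeDist {V : Type*} (G : SimpleGraph V) (w : V) :
    Sym2 V → ℕ :=
  Sym2.lift ⟨fun a b => min (G.dist w a) (G.dist w b), fun _ _ => min_comm _ _⟩

/-- A finite set `S` of vertices is an edge metric generator if every two distinct edges are
resolved by (have different distances to) some vertex of `S`. -/
def SimpleGraph.IsEdgeMetricGenerator {V : Type*} (G : SimpleGraph V) (S : Finset V) : Prop :=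
  ∀ e₁ ∈ G.edgeSet, ∀ e₂ ∈ G.edgeSet, e₁ ≠ e₂ →
    ∃ w ∈ S, G.vertexEdgeDist w e₁ ≠ G.vertexEdgeDist w e₂

/-- The edge metric dimension: the smallest cardinality of an edge metric generator. -/
noncomputable def SimpleGraph.edgeMetricDim {V : Type*} (G : SimpleGraph V) : ℕ :=
  sInf {m : ℕ | ∃ S : Finset V, G.IsEdgeMetricGenerator S ∧ S.card = m}

/-- An edge metric basis: an edge metric generator of the smallest cardinality. -/
def SimpleGraph.IsEdgeMetricBasis {V : Type*} (G : SimpleGraph V) (S : Finset V) : Prop :=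
  G.IsEdgeMetricGenerator S ∧ S.card = G.edgeMetricDim

/-!
Every distance in `GP(n, 2)`, `n ≥ 5`, is given by an explicit formula: a shortest path goes around
the cycle one way or the other, and it either stays on the outer rim or uses the inner rim, where
one edge changes the index by two. `SimpleGraph.dist_eq_of_local` reduces the formula
(`GP2.dist_eq_vertexDist`) to local checks along the three kinds of edges. Hence whether a set of
vertices is an edge metric generator becomes a statement about natural numbers
(`GP2.isEdgeMetricGenerator_iff`).

The lower bound `3` comes from the degree. If `w` is in a generator `S`, then the three edges at `w`
all have distance `0` from `w`, while any other vertex sees them at no more than two distances,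
so one further vertex is not enough
(`SimpleGraph.IsEdgeMetricGenerator.three_le_card`). For `n = 5, 6, 7, 9` each triple of vertices
leaves some pair of edges unresolved; this finite search is evaluated by the kernel
(`GP2.four_le_card_of_triplesFail`), as are the generators for small `n` (`GP2.resolving_sound`).

For `n = 4 * t + r` with `t` arbitrary, the distances from the three proposed vertices to the edge
of a given kind with index `i` are piecewise linear in `i` and `t`: for `i` of a fixed parity there
are boundedly many arcs, with ends linear in `t`, on which each doubled distance is a linear form.
A small evaluator computes these forms from the distance formula, deciding each minimum by the signs
of linear forms at the ends of the arc (`GP2.Arc.code_sound`). Two arcs have no vector of distances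
in common if some combination of the three coordinates with coefficients `0, 1, -1` differs on
them, either by size or by a congruence (`GP2.apart_sound`). So a certificate for all large `t`
consists of the ends of the arcs alone (`GP2.Certificate.resolves`), and for each residue `r` it is
verified by evaluation.
-/

/-! ### Distances determined by local conditions -/

/-- A function on the vertices of a graph that vanishes at `w` and only there, changes by at most
one along each edge, and can be lowered by one step away from `w`, is the distance from `w`. -/
theorem SimpleGraph.dist_eq_of_local {V : Type*} {G : SimpleGraph V} {w : V} {f : V → ℕ}
    (hw : f w = 0) (hlip : ∀ x y, G.Adj x y → f y ≤ f x + 1)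
    (hdesc : ∀ x, x ≠ w → ∃ y, G.Adj x y ∧ f x = f y + 1) (x : V) :
    G.dist w x = f x := by
  have upper : ∀ m x, f x = m → ∃ p : G.Walk x w, p.length = m := by
    intro m
    induction m with
    | zero =>
      intro x hx
      by_cases h : x = w
      · subst h; exact ⟨.nil, rfl⟩
      · obtain ⟨y, -, hy⟩ := hdesc x h
        omega
    | succ m ih =>
      intro x hx
      have h : x ≠ w := by rintro rfl; omega
      obtain ⟨y, hxy, hy⟩ := hdesc x h
      obtain ⟨p, hp⟩ := ih y (by omega)
      exact ⟨.cons hxy p, by simp [hp]⟩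
  have lower : ∀ {a b : V} (p : G.Walk a b), f b ≤ f a + p.length := by
    intro a b p
    induction p with
    | nil => simp
    | cons h p ih =>
      have := hlip _ _ h
      simp only [SimpleGraph.Walk.length_cons]
      omega
  obtain ⟨p, hp⟩ := upper _ x rfl
  have hr : G.Reachable w x := ⟨p.reverse⟩
  refine le_antisymm ?_ ?_
  · rw [← hp, ← p.length_reverse]
    exact SimpleGraph.dist_le _
  · obtain ⟨q, hq⟩ := hr.exists_walk_length_eq_dist
    have := lower q
    omega

/-! ### The generalized Petersen graphs with `k = 2` -/

namespace GP2

/-- Distance from `u_0` to `u_x` in the infinite analogue of `GP(n, 2)`: stay on the outer rim,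
or descend, travel along the inner rim in steps of two, and come back. -/
def lineUU (x : ℕ) : ℕ := min x (2 + (x + 1) / 2)

/-- Distance between `u_0` and `v_x` in the infinite analogue of `GP(n, 2)`. -/
def lineUV (x : ℕ) : ℕ := 1 + (x + 1) / 2

/-- Distance from `v_0` to `v_x` in the infinite analogue of `GP(n, 2)`: for odd `x` the
path has to use one edge of the outer rim. -/
def lineVV (x : ℕ) : ℕ := if x % 2 = 0 then x / 2 else 2 + (x + 1) / 2

/-- The smaller of the values of `F` at the two arcs of a cycle of length `n` cut out by two points
at offset `x`. -/
def around (F : ℕ → ℕ) (n x : ℕ) : ℕ := min (F x) (F (n - x))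

/-- The distance between two vertices of `GP(n, 2)` for `n ≥ 5`, as an explicit function of their
kinds and the offset between their indices. -/
def vertexDist (n : ℕ) : ZMod n ⊕ ZMod n → ZMod n ⊕ ZMod n → ℕ
  | .inl c, .inl y => around lineUU n (y - c).val
  | .inl c, .inr y => around lineUV n (y - c).val
  | .inr c, .inl y => around lineUV n (y - c).val
  | .inr c, .inr y => around lineVV n (y - c).val

theorem adj_rim {n : ℕ} (hn : 5 ≤ n) (i : ZMod n) :
    (generalizedPetersen n 2).Adj (.inl i) (.inl (i + 1)) := by
  have : Fact (1 < n) := ⟨by omega⟩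
  refine (SimpleGraph.fromRel_adj _ _ _).2 ⟨?_, Or.inl (Or.inl ⟨i, rfl, rfl⟩)⟩
  simp

theorem adj_spoke {n : ℕ} (i : ZMod n) :
    (generalizedPetersen n 2).Adj (.inl i) (.inr i) :=
  (SimpleGraph.fromRel_adj _ _ _).2 ⟨by simp, Or.inl (Or.inr (Or.inl ⟨i, rfl, rfl⟩))⟩

theorem adj_inner {n : ℕ} (hn : 5 ≤ n) (i : ZMod n) :
    (generalizedPetersen n 2).Adj (.inr i) (.inr (i + 2)) := by
  have h2 : (2 : ZMod n) ≠ 0 := by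
    intro h
    have := (ZMod.natCast_eq_zero_iff 2 n).1 (by exact_mod_cast h)
    have := Nat.le_of_dvd (by norm_num) this
    omega
  refine (SimpleGraph.fromRel_adj _ _ _).2 ⟨?_, Or.inl (Or.inr (Or.inr ⟨i, rfl, by simp⟩))⟩
  simpa using h2

/-- A symmetric relation that holds along the three kinds of edges holds along every edge. -/
theorem adj_induction {n : ℕ} {P : ZMod n ⊕ ZMod n → ZMod n ⊕ ZMod n → Prop}
    (symm : ∀ x y, P x y → P y x)
    (rim : ∀ i, P (.inl i) (.inl (i + 1))) (spoke : ∀ i, P (.inl i) (.inr i))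
    (inner : ∀ i, P (.inr i) (.inr (i + 2))) {x y : ZMod n ⊕ ZMod n}
    (h : (generalizedPetersen n 2).Adj x y) : P x y := by
  have key : ∀ x y : ZMod n ⊕ ZMod n,
      ((∃ i : ZMod n, x = Sum.inl i ∧ y = Sum.inl (i + 1)) ∨
      (∃ i : ZMod n, x = Sum.inl i ∧ y = Sum.inr i) ∨
      (∃ i : ZMod n, x = Sum.inr i ∧ y = Sum.inr (i + ((2 : ℕ) : ZMod n)))) → P x y := by
    rintro x y (⟨i, rfl, rfl⟩ | ⟨i, rfl, rfl⟩ | ⟨i, rfl, rfl⟩)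
    exacts [rim i, spoke i, by simpa using inner i]
  obtain ⟨-, h | h⟩ := (SimpleGraph.fromRel_adj _ _ _).1 h
  exacts [key _ _ h, symm _ _ (key _ _ h)]

theorem val_add_small {n : ℕ} {s : ℕ} (hn : s < n) (i c : ZMod n) :
    (i + s - c).val = if (i - c).val + s < n then (i - c).val + s else (i - c).val + s - n := by
  have : NeZero n := ⟨by omega⟩
  have hs : ((s : ℕ) : ZMod n).val = s := ZMod.val_cast_of_lt hn
  have hlt := ZMod.val_lt (i - c)
  rw [show i + s - c = (i - c) + s by ring, ZMod.val_add, hs]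
  split_ifs with h
  · exact Nat.mod_eq_of_lt h
  · rw [Nat.mod_eq_sub_mod (by omega), Nat.mod_eq_of_lt (by omega)]

theorem val_sub_small {n : ℕ} {s : ℕ} (hn : s < n) (i c : ZMod n) :
    (i - (s : ZMod n) - c).val =
      if s ≤ (i - c).val then (i - c).val - s else (i - c).val + n - s := by
  have : NeZero n := ⟨by omega⟩
  have h := val_add_small hn (i - (s : ZMod n)) c
  have h1 := ZMod.val_lt (i - c)
  have h2 := ZMod.val_lt (i - (s : ZMod n) - c)
  rw [sub_add_cancel] at h
  split_ifs at h ⊢ <;> omega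

theorem vertexDist_self {n : ℕ} (w : ZMod n ⊕ ZMod n) : vertexDist n w w = 0 := by
  cases w <;> simp [vertexDist, around, lineUU, lineVV]

theorem vertexDist_lipschitz {n : ℕ} (hn : 5 ≤ n) (w : ZMod n ⊕ ZMod n) {x y : ZMod n ⊕ ZMod n}
    (h : (generalizedPetersen n 2).Adj x y) :
    vertexDist n w y ≤ vertexDist n w x + 1 := by
  have : NeZero n := ⟨by omega⟩
  suffices vertexDist n w y ≤ vertexDist n w x + 1 ∧ vertexDist n w x ≤ vertexDist n w y + 1 from
    this.1
  refine adj_induction (P := fun x y => vertexDist n w y ≤ vertexDist n w x + 1 ∧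
    vertexDist n w x ≤ vertexDist n w y + 1) (fun _ _ h => h.symm) ?_ ?_ ?_ h
  · intro i
    rcases w with c | c <;>
    · have h1 := val_add_small (s := 1) (by omega) i c
      have hlt := ZMod.val_lt (i - c)
      rw [Nat.cast_one] at h1
      simp only [vertexDist, h1, around, lineUU, lineUV]
      generalize (i - c).val = x at *
      split_ifs <;> omega
  · intro i
    rcases w with c | c <;>
    · have hlt := ZMod.val_lt (i - c)
      simp only [vertexDist, around, lineUU, lineUV, lineVV]
      generalize (i - c).val = x at *
      try split_ifs
      all_goals omega
  · intro i
    rcases w with c | c <;>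
    · have h1 := val_add_small (s := 2) (by omega) i c
      have hlt := ZMod.val_lt (i - c)
      rw [Nat.cast_ofNat] at h1
      simp only [vertexDist, h1, around, lineUV, lineVV]
      generalize (i - c).val = x at *
      split_ifs <;> omega

/-! In `descent_XY` the letters are the kinds of the target `w` and of the vertex `x ≠ w`, and the
claim is that some neighbour of `x` is closer to `w`. For instance, a path from `u_i` towards
`u_0` starts along the rim if `u_0` is at most four steps away and along the spoke otherwise, and a
path towards `v_0` takes a step along the rim exactly when the offset has the wrong parity. -/

theorem descent_UU {n x : ℕ} (hn : 5 ≤ n) (hlt : x < n) (h0 : x ≠ 0) :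
    around lineUU n x = around lineUU n (if x + 1 < n then x + 1 else x + 1 - n) + 1 ∨
    around lineUU n x = around lineUU n (if 1 ≤ x then x - 1 else x + n - 1) + 1 ∨
    around lineUU n x = around lineUV n x + 1 := by
  simp only [around, lineUU, lineUV]
  rcases (by omega : x ≤ 4 ∨ n ≤ x + 4 ∨ (4 < x ∧ x + 4 < n)) with h | h | h
  · by_cases 2 * x ≤ n
    · right; left; split_ifs <;> omega
    · left; split_ifs <;> omega
  · by_cases 2 * x ≤ n
    · right; left; split_ifs <;> omega
    · left; split_ifs <;> omega
  · right; right; omega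

theorem descent_VU {n x : ℕ} (hn : 5 ≤ n) (hlt : x < n) :
    around lineUV n x = around lineUV n (if x + 1 < n then x + 1 else x + 1 - n) + 1 ∨
    around lineUV n x = around lineUV n (if 1 ≤ x then x - 1 else x + n - 1) + 1 ∨
    around lineUV n x = around lineVV n x + 1 := by
  simp only [around, lineUV, lineVV]
  by_cases h : 2 * x ≤ n
  · by_cases hx : x % 2 = 0
    · right; right; split_ifs <;> omega
    · right; left; split_ifs <;> omega
  · by_cases hx : (n - x) % 2 = 0
    · right; right; split_ifs <;> omega
    · left; split_ifs <;> omega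

theorem descent_UV {n x : ℕ} (hn : 5 ≤ n) (hlt : x < n) :
    around lineUV n x = around lineUV n (if x + 2 < n then x + 2 else x + 2 - n) + 1 ∨
    around lineUV n x = around lineUV n (if 2 ≤ x then x - 2 else x + n - 2) + 1 ∨
    around lineUV n x = around lineUU n x + 1 := by
  simp only [around, lineUU, lineUV]
  by_cases h : 2 * x ≤ n
  · by_cases hx : x ≤ 1
    · right; right; omega
    · right; left; split_ifs <;> omega
  · by_cases hx : n - x ≤ 1
    · right; right; omega
    · left; split_ifs <;> omega

theorem descent_VV {n x : ℕ} (hn : 5 ≤ n) (hlt : x < n) (h0 : x ≠ 0) :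
    around lineVV n x = around lineVV n (if x + 2 < n then x + 2 else x + 2 - n) + 1 ∨
    around lineVV n x = around lineVV n (if 2 ≤ x then x - 2 else x + n - 2) + 1 ∨
    around lineVV n x = around lineUV n x + 1 := by
  simp only [around, lineUV, lineVV]
  by_cases h : lineVV x ≤ lineVV (n - x) <;> simp only [lineVV] at h
  · by_cases hx : x % 2 = 0
    · right; left; split_ifs at * <;> omega
    · right; right; split_ifs at * <;> omega
  · by_cases hx : (n - x) % 2 = 0
    · left; split_ifs at * <;> omega
    · right; right; split_ifs at * <;> omega

theorem vertexDist_descent {n : ℕ} (hn : 5 ≤ n) (w x : ZMod n ⊕ ZMod n) (hx : x ≠ w) :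
    ∃ y, (generalizedPetersen n 2).Adj x y ∧ vertexDist n w x = vertexDist n w y + 1 := by
  have : NeZero n := ⟨by omega⟩
  rcases x with i | i
  · suffices vertexDist n w (.inl i) = vertexDist n w (.inl (i + 1)) + 1 ∨
        vertexDist n w (.inl i) = vertexDist n w (.inl (i - 1)) + 1 ∨
        vertexDist n w (.inl i) = vertexDist n w (.inr i) + 1 by
      rcases this with h | h | h
      · exact ⟨_, adj_rim hn i, h⟩
      · exact ⟨_, by simpa using (adj_rim hn (i - 1)).symm, h⟩
      · exact ⟨_, adj_spoke i, h⟩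
    rcases w with c | c
    all_goals
      have h1 := val_add_small (s := 1) (by omega) i c
      have h2 := val_sub_small (s := 1) (by omega) i c
      have hlt := ZMod.val_lt (i - c)
      rw [Nat.cast_one] at h1 h2
      have h0 : (i - c).val = 0 → i = c := fun h => sub_eq_zero.1 ((ZMod.val_eq_zero _).1 h)
      simp only [vertexDist, h1, h2]
      simp only [ne_eq, Sum.inl.injEq, reduceCtorEq, not_false_eq_true] at hx
    · exact descent_UU hn hlt (fun h => hx (h0 h))
    · exact descent_VU hn hlt
  · suffices vertexDist n w (.inr i) = vertexDist n w (.inr (i + 2)) + 1 ∨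
        vertexDist n w (.inr i) = vertexDist n w (.inr (i - 2)) + 1 ∨
        vertexDist n w (.inr i) = vertexDist n w (.inl i) + 1 by
      rcases this with h | h | h
      · exact ⟨_, adj_inner hn i, h⟩
      · exact ⟨_, by simpa using (adj_inner hn (i - 2)).symm, h⟩
      · exact ⟨_, (adj_spoke i).symm, h⟩
    rcases w with c | c
    all_goals
      have h1 := val_add_small (s := 2) (by omega) i c
      have h2 := val_sub_small (s := 2) (by omega) i c
      have hlt := ZMod.val_lt (i - c)
      rw [Nat.cast_ofNat] at h1 h2
      have h0 : (i - c).val = 0 → i = c := fun h => sub_eq_zero.1 ((ZMod.val_eq_zero _).1 h)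
      simp only [vertexDist, h1, h2]
      simp only [ne_eq, Sum.inr.injEq, reduceCtorEq, not_false_eq_true] at hx
    · exact descent_UV hn hlt
    · exact descent_VV hn hlt (fun h => hx (h0 h))

theorem dist_eq_vertexDist {n : ℕ} (hn : 5 ≤ n) (w x : ZMod n ⊕ ZMod n) :
    (generalizedPetersen n 2).dist w x = vertexDist n w x :=
  SimpleGraph.dist_eq_of_local (vertexDist_self w)
    (fun _ _ h => vertexDist_lipschitz hn w h) (vertexDist_descent hn w) x

/-! ### Distances to edges -/

/-- The three kinds of edges of `GP(n, 2)`: `u_i u_{i+1}`, `u_i v_i` and `v_i v_{i+2}`. -/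
inductive EdgeKind
  | rim
  | spoke
  | inner
  deriving DecidableEq

/-- The edge of the given kind and index. -/
def edge (n : ℕ) : EdgeKind → ℕ → Sym2 (ZMod n ⊕ ZMod n)
  | .rim, i => s(.inl i, .inl (i + 1))
  | .spoke, i => s(.inl i, .inr i)
  | .inner, i => s(.inr i, .inr (i + 2))

/-- The residue of `x + s` modulo `n`, for `x, s < n`. -/
def step (n s x : ℕ) : ℕ := if x + s < n then x + s else x + s - n

/-- The residue of `i - c` modulo `n`, for `c, i < n`. -/
def offset (n c i : ℕ) : ℕ := if c ≤ i then i - c else i + n - c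

/-- The distance from `u_0` to the edge of the given kind and index. -/
def fromU (n : ℕ) : EdgeKind → ℕ → ℕ
  | .rim, x => min (around lineUU n x) (around lineUU n (step n 1 x))
  | .spoke, x => min (around lineUU n x) (around lineUV n x)
  | .inner, x => min (around lineUV n x) (around lineUV n (step n 2 x))

/-- The distance from `v_0` to the edge of the given kind and index. -/
def fromV (n : ℕ) : EdgeKind → ℕ → ℕ
  | .rim, x => min (around lineUV n x) (around lineUV n (step n 1 x))
  | .spoke, x => min (around lineUV n x) (around lineVV n x)
  | .inner, x => min (around lineVV n x) (around lineVV n (step n 2 x))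

/-- The vertex `u_i` or `v_i` named by a natural number `i`. -/
def vertex (n : ℕ) : ℕ ⊕ ℕ → ZMod n ⊕ ZMod n := Sum.map Nat.cast Nat.cast

/-- The distance from a named vertex to the edge of the given kind and index. -/
def edgeDist (n : ℕ) : ℕ ⊕ ℕ → EdgeKind × ℕ → ℕ
  | .inl c, e => fromU n e.1 (offset n c e.2)
  | .inr c, e => fromV n e.1 (offset n c e.2)

/-- The names of the vertices: `u_0, …, u_{n-1}` and `v_0, …, v_{n-1}`. -/
def vertexNames (n : ℕ) : List (ℕ ⊕ ℕ) :=
  (List.range n).map Sum.inl ++ (List.range n).map Sum.inr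

/-- The names of the edges: a kind, and an index below `n`. -/
def edgeNames (n : ℕ) : List (EdgeKind × ℕ) :=
  [EdgeKind.rim, .spoke, .inner].flatMap fun τ => (List.range n).map (τ, ·)

theorem mem_edgeNames {n : ℕ} {e : EdgeKind × ℕ} : e ∈ edgeNames n ↔ e.2 < n := by
  obtain ⟨τ, i⟩ := e
  cases τ <;> simp [edgeNames]

theorem exists_vertex {n : ℕ} [NeZero n] (x : ZMod n ⊕ ZMod n) :
    ∃ w ∈ vertexNames n, vertex n w = x := by
  rcases x with x | x
  · exact ⟨.inl x.val, by simp [vertexNames, ZMod.val_lt], by simp [vertex]⟩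
  · exact ⟨.inr x.val, by simp [vertexNames, ZMod.val_lt], by simp [vertex]⟩

theorem mem_edgeSet_iff {n : ℕ} (hn : 5 ≤ n) {e : Sym2 (ZMod n ⊕ ZMod n)} :
    e ∈ (generalizedPetersen n 2).edgeSet ↔ ∃ a ∈ edgeNames n, e = edge n a.1 a.2 := by
  have : NeZero n := ⟨by omega⟩
  constructor
  · induction e with | _ x y
    intro h
    refine adj_induction (P := fun x y => ∃ a ∈ edgeNames n, s(x, y) = edge n a.1 a.2)
      (fun x y h => by rwa [Sym2.eq_swap]) ?_ ?_ ?_ h <;> intro i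
    · exact ⟨(.rim, i.val), mem_edgeNames.2 (ZMod.val_lt i), by simp [edge]⟩
    · exact ⟨(.spoke, i.val), mem_edgeNames.2 (ZMod.val_lt i), by simp [edge]⟩
    · exact ⟨(.inner, i.val), mem_edgeNames.2 (ZMod.val_lt i), by simp [edge]⟩
  · rintro ⟨⟨τ, i⟩, -, rfl⟩
    cases τ
    exacts [adj_rim hn i, adj_spoke _, adj_inner hn i]

theorem natCast_ne_zero {n s : ℕ} (hs : 0 < s) (hn : s < n) : (s : ZMod n) ≠ 0 := fun h =>
  absurd (Nat.le_of_dvd hs ((ZMod.natCast_eq_zero_iff s n).1 h)) (by omega)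

theorem natCast_inj {n i j : ℕ} (hi : i < n) (hj : j < n) (h : (i : ZMod n) = j) : i = j := by
  simpa only [ZMod.val_cast_of_lt, hi, hj] using congrArg ZMod.val h

theorem edge_injective {n : ℕ} (hn : 5 ≤ n) {a b : EdgeKind × ℕ} (ha : a ∈ edgeNames n)
    (hb : b ∈ edgeNames n) (h : edge n a.1 a.2 = edge n b.1 b.2) : a = b := by
  obtain ⟨τ, i⟩ := a
  obtain ⟨τ', j⟩ := b
  rw [mem_edgeNames] at ha hb
  have h2 : (2 : ZMod n) ≠ 0 := by exact_mod_cast natCast_ne_zero (s := 2) (by omega) (by omega)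
  have h4 : (4 : ZMod n) ≠ 0 := by exact_mod_cast natCast_ne_zero (s := 4) (by omega) (by omega)
  suffices τ = τ' ∧ (i : ZMod n) = j from Prod.ext this.1 (natCast_inj ha hb this.2)
  cases τ <;> cases τ' <;>
    simp only [edge, Sym2.eq_iff, Sum.inl.injEq, Sum.inr.injEq, reduceCtorEq, and_false,
      false_and, or_false, or_self, and_self] at h
  · refine ⟨rfl, h.elim And.left fun h => absurd ?_ h2⟩
    linear_combination h.2 - h.1
  · exact ⟨rfl, h⟩
  · refine ⟨rfl, h.elim And.left fun h => absurd ?_ h4⟩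
    linear_combination h.2 - h.1

theorem val_natCast_sub {n c i : ℕ} (hc : c < n) (hi : i < n) :
    ((i : ZMod n) - c).val = offset n c i := by
  have := val_sub_small hc (i : ZMod n) 0
  simpa [ZMod.val_cast_of_lt hi, offset] using this

theorem vertexEdgeDist_eq {n : ℕ} (hn : 5 ≤ n) {w : ℕ ⊕ ℕ} (hw : w ∈ vertexNames n)
    {e : EdgeKind × ℕ} (he : e ∈ edgeNames n) :
    (generalizedPetersen n 2).vertexEdgeDist (vertex n w) (edge n e.1 e.2) = edgeDist n w e := by
  obtain ⟨τ, i⟩ := e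
  have hi : i < n := mem_edgeNames.1 he
  rcases w with c | c
  all_goals
    have hc : c < n := by simpa [vertexNames] using hw
    have h1 := val_add_small (s := 1) (by omega) (i : ZMod n) c
    have h2 := val_add_small (s := 2) (by omega) (i : ZMod n) c
    rw [Nat.cast_one] at h1
    rw [Nat.cast_ofNat] at h2
    rw [val_natCast_sub hc hi] at h1 h2
    cases τ <;>
      simp [edge, SimpleGraph.vertexEdgeDist, dist_eq_vertexDist hn, vertexDist, vertex, edgeDist,
        fromU, fromV, step, h1, h2, val_natCast_sub hc hi]

/-! ### Edge metric generators in terms of explicit distances -/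

theorem isEdgeMetricGenerator_iff {n : ℕ} (hn : 5 ≤ n) {S : Finset (ZMod n ⊕ ZMod n)}
    {W : List (ℕ ⊕ ℕ)} (hW : ∀ w ∈ W, w ∈ vertexNames n)
    (hS : ∀ x, x ∈ S ↔ ∃ w ∈ W, vertex n w = x) :
    (generalizedPetersen n 2).IsEdgeMetricGenerator S ↔
      ∀ a ∈ edgeNames n, ∀ b ∈ edgeNames n, (∀ w ∈ W, edgeDist n w a = edgeDist n w b) → a = b := by
  constructor
  · intro h a ha b hb hab
    by_contra hne
    obtain ⟨x, hx, hd⟩ := h _ ((mem_edgeSet_iff hn).2 ⟨a, ha, rfl⟩) _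
      ((mem_edgeSet_iff hn).2 ⟨b, hb, rfl⟩) fun h => hne (edge_injective hn ha hb h)
    obtain ⟨w, hw, rfl⟩ := (hS x).1 hx
    rw [vertexEdgeDist_eq hn (hW w hw) ha, vertexEdgeDist_eq hn (hW w hw) hb] at hd
    exact hd (hab w hw)
  · intro h e₁ h₁ e₂ h₂ hne
    obtain ⟨a, ha, rfl⟩ := (mem_edgeSet_iff hn).1 h₁
    obtain ⟨b, hb, rfl⟩ := (mem_edgeSet_iff hn).1 h₂
    by_contra! hcon
    refine hne (congrArg (fun e => edge n e.1 e.2) (h a ha b hb fun w hw => ?_))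
    rw [← vertexEdgeDist_eq hn (hW w hw) ha, ← vertexEdgeDist_eq hn (hW w hw) hb]
    exact hcon _ ((hS _).2 ⟨w, hw, rfl⟩)

end GP2

/-! ### A lower bound from a vertex of degree three -/

/-- An edge metric generator of a graph all of whose vertices have three neighbours has at least
three elements: if `w` belongs to it, the three edges at `w` are all at distance `0` from `w`,
while from any other vertex they show at most two different distances. -/
theorem SimpleGraph.IsEdgeMetricGenerator.three_le_card {V : Type*} [Nonempty V]
    {G : SimpleGraph V} {S : Finset V} (hS : G.IsEdgeMetricGenerator S)
    (hdeg : ∀ w, ∃ a b c, G.Adj w a ∧ G.Adj w b ∧ G.Adj w c ∧ a ≠ b ∧ a ≠ c ∧ b ≠ c) :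
    3 ≤ S.card := by
  classical
  have resolve : ∀ {w a b : V}, G.Adj w a → G.Adj w b → a ≠ b →
      ∃ z ∈ S, G.vertexEdgeDist z s(w, a) ≠ G.vertexEdgeDist z s(w, b) := fun ha hb hab =>
    hS _ ha _ hb fun h => hab (Sym2.congr_right.1 h)
  have hne : ∃ w, w ∈ S := by
    obtain ⟨a, b, -, ha, hb, -, hab, -⟩ := hdeg (Classical.arbitrary V)
    obtain ⟨z, hz, -⟩ := resolve ha hb hab
    exact ⟨z, hz⟩
  obtain ⟨w, hw⟩ := hne
  obtain ⟨a, b, c, ha, hb, hc, hab, hac, hbc⟩ := hdeg w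
  by_contra! hcard
  have hone : (S.erase w).card ≤ 1 := by rw [Finset.card_erase_of_mem hw]; omega
  have resolve' : ∀ {a b : V}, G.Adj w a → G.Adj w b → a ≠ b →
      ∃ z ∈ S.erase w, G.vertexEdgeDist z s(w, a) ≠ G.vertexEdgeDist z s(w, b) := by
    intro a b ha hb hab
    obtain ⟨z, hz, h⟩ := resolve ha hb hab
    refine ⟨z, Finset.mem_erase.2 ⟨?_, hz⟩, h⟩
    rintro rfl
    simp [SimpleGraph.vertexEdgeDist] at h
  obtain ⟨z, hz, h1⟩ := resolve' ha hb hab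
  obtain ⟨z', hz', h2⟩ := resolve' ha hc hac
  obtain ⟨z'', hz'', h3⟩ := resolve' hb hc hbc
  obtain rfl := Finset.card_le_one.1 hone _ hz _ hz'
  obtain rfl := Finset.card_le_one.1 hone _ hz _ hz''
  have hd : ∀ x, G.Adj w x → G.vertexEdgeDist z s(w, x) = G.dist z w ∨
      G.vertexEdgeDist z s(w, x) + 1 = G.dist z w := by
    intro x hx
    have := hx.diff_dist_adj (u := z)
    simp only [SimpleGraph.vertexEdgeDist, Sym2.lift_mk]
    omega
  have := hd a ha
  have := hd b hb
  have := hd c hc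
  omega

namespace GP2

theorem three_le_card {n : ℕ} (hn : 5 ≤ n) {S : Finset (ZMod n ⊕ ZMod n)}
    (hS : (generalizedPetersen n 2).IsEdgeMetricGenerator S) : 3 ≤ S.card := by
  have h2 : (2 : ZMod n) ≠ 0 := by exact_mod_cast natCast_ne_zero (s := 2) (by omega) (by omega)
  have h4 : (4 : ZMod n) ≠ 0 := by exact_mod_cast natCast_ne_zero (s := 4) (by omega) (by omega)
  have : Nonempty (ZMod n ⊕ ZMod n) := ⟨.inl 0⟩
  refine hS.three_le_card ?_
  rintro (i | i)
  · refine ⟨.inl (i + 1), .inl (i - 1), .inr i, adj_rim hn i,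
      by simpa using (adj_rim hn (i - 1)).symm, adj_spoke i, ?_, by simp, by simp⟩
    intro h
    exact h2 (by linear_combination Sum.inl_injective h)
  · refine ⟨.inr (i + 2), .inr (i - 2), .inl i, adj_inner hn i,
      by simpa using (adj_inner hn (i - 2)).symm, (adj_spoke i).symm, ?_, by simp, by simp⟩
    intro h
    exact h4 (by linear_combination Sum.inr_injective h)

end GP2

/-- A generator no larger than any other one realizes the edge metric dimension. -/
theorem SimpleGraph.IsEdgeMetricGenerator.card_eq_edgeMetricDim {V : Type*} {G : SimpleGraph V}
    {S : Finset V} (hS : G.IsEdgeMetricGenerator S)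
    (hmin : ∀ T : Finset V, G.IsEdgeMetricGenerator T → S.card ≤ T.card) :
    S.card = G.edgeMetricDim := by
  refine le_antisymm ?_ (Nat.sInf_le ⟨S, hS, rfl⟩)
  refine le_csInf ⟨_, S, hS, rfl⟩ ?_
  rintro _ ⟨T, hT, rfl⟩
  exact hmin T hT

theorem SimpleGraph.IsEdgeMetricGenerator.mono {V : Type*} {G : SimpleGraph V}
    {S T : Finset V} (hS : G.IsEdgeMetricGenerator S) (hST : S ⊆ T) :
    G.IsEdgeMetricGenerator T := fun e₁ h₁ e₂ h₂ hne =>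
  let ⟨w, hw, h⟩ := hS e₁ h₁ e₂ h₂ hne
  ⟨w, hST hw, h⟩

namespace GP2

/-! ### Symbolic evaluation of distances -/

/-- The integer linear form `ci * i + ct * t + c` in an index `i` and a parameter `t`. -/
structure Lin where
  ci : ℤ
  ct : ℤ
  c : ℤ

namespace Lin

/-- The value of a linear form. -/
def eval (L : Lin) (t i : ℤ) : ℤ := L.ci * i + L.ct * t + L.c

def add (L M : Lin) : Lin := ⟨L.ci + M.ci, L.ct + M.ct, L.c + M.c⟩

def sub (L M : Lin) : Lin := ⟨L.ci - M.ci, L.ct - M.ct, L.c - M.c⟩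

/-- Adding a constant to a linear form. -/
def shift (L : Lin) (k : ℤ) : Lin := ⟨L.ci, L.ct, L.c + k⟩

/-- Multiplying a linear form by a constant. -/
def smul (k : ℤ) (L : Lin) : Lin := ⟨k * L.ci, k * L.ct, k * L.c⟩

variable (L M : Lin) (t i : ℤ)

theorem eval_add : (L.add M).eval t i = L.eval t i + M.eval t i := by
  simp only [add, eval]; ring

theorem eval_sub : (L.sub M).eval t i = L.eval t i - M.eval t i := by
  simp only [sub, eval]; ring

theorem eval_shift (k : ℤ) : (L.shift k).eval t i = L.eval t i + k := by
  simp only [shift, eval]; ring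

theorem eval_smul (k : ℤ) : (smul k L).eval t i = k * L.eval t i := by
  simp only [smul, eval]; ring

end Lin

/-- A set of indices: those of one parity between `first` and `last`. A pair `(a, b)` stands for
the bound `a * t + b`, where `t` is the parameter in `n = 4 * t + r`. -/
structure Arc where
  parity : ℤ
  first : ℤ × ℤ
  last : ℤ × ℤ

namespace Arc

/-- The index `i` belongs to the arc, for the parameter `t`. -/
def Covers (A : Arc) (t i : ℤ) : Prop :=
  i % 2 = A.parity ∧ A.first.1 * t + A.first.2 ≤ i ∧ i ≤ A.last.1 * t + A.last.2

/-- A sufficient test for `L` to be non-negative on the arc whenever `T ≤ t`: `L` is smallest at an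
end of the arc, where it is a linear form in `t`, and that one is tested for being nondecreasing
and non-negative at `T`. -/
def nonneg (T : ℤ) (A : Arc) (L : Lin) : Bool :=
  let e := if 0 ≤ L.ci then A.first else A.last
  decide (0 ≤ L.ct + L.ci * e.1) && decide (0 ≤ T * (L.ct + L.ci * e.1) + (L.c + L.ci * e.2))

theorem nonneg_sound {T : ℤ} {A : Arc} {L : Lin} (h : A.nonneg T L = true) {t i : ℤ} (ht : T ≤ t)
    (hi : A.Covers t i) : 0 ≤ L.eval t i := by
  obtain ⟨-, h1, h2⟩ := hi
  simp only [nonneg, Bool.and_eq_true, decide_eq_true_eq] at h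
  simp only [Lin.eval]
  split_ifs at h with hs
  · nlinarith [mul_nonneg hs (sub_nonneg.2 h1), mul_nonneg h.1 (sub_nonneg.2 ht)]
  · nlinarith [mul_nonneg (neg_nonneg.2 (not_le.1 hs).le) (sub_nonneg.2 h2),
      mul_nonneg h.1 (sub_nonneg.2 ht)]

/-- The minimum of two linear forms, if the tests show that one of them is the smaller one on the
whole arc. -/
def min (T : ℤ) (A : Arc) (L M : Lin) : Option Lin :=
  if A.nonneg T (M.sub L) then some L else if A.nonneg T (L.sub M) then some M else none

theorem min_sound {T : ℤ} {A : Arc} {L M R : Lin} (h : A.min T L M = some R) {t i : ℤ} (ht : T ≤ t)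
    (hi : A.Covers t i) : R.eval t i = Min.min (L.eval t i) (M.eval t i) := by
  unfold min at h
  split_ifs at h with h1 h2
  · have := nonneg_sound h1 ht hi
    rw [Lin.eval_sub] at this
    cases h
    omega
  · have := nonneg_sound h2 ht hi
    rw [Lin.eval_sub] at this
    cases h
    omega

/-- The constant parity on the arc of the values of a linear form. -/
def parityOf (A : Arc) (L : Lin) : Option ℤ :=
  if L.ct % 2 = 0 then some ((L.ci * A.parity + L.c) % 2) else none

theorem parityOf_sound {A : Arc} {L : Lin} {p : ℤ} (h : A.parityOf L = some p) {t i : ℤ}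
    (hi : A.Covers t i) : L.eval t i % 2 = p := by
  unfold parityOf at h
  split_ifs at h with h1
  cases h
  obtain ⟨h, -, -⟩ := hi
  have h2 : L.ct * t % 2 = 0 := by rw [Int.mul_emod, h1]; simp
  have h3 : L.ci * i % 2 = L.ci * A.parity % 2 := by rw [Int.mul_emod, ← h]; simp [Int.mul_emod]
  simp only [Lin.eval]
  omega

/-- The *doubled* value of `lineUU`; doubling keeps the coefficients integral. -/
def lineUU₂ (T : ℤ) (A : Arc) (x : Lin) : Option Lin :=
  (A.parityOf x).bind fun p => A.min T (Lin.smul 2 x) (x.shift (4 + p))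

/-- The doubled value of `lineUV`. -/
def lineUV₂ (_T : ℤ) (A : Arc) (x : Lin) : Option Lin :=
  (A.parityOf x).bind fun p => some (x.shift (2 + p))

/-- The doubled value of `lineVV`. -/
def lineVV₂ (_T : ℤ) (A : Arc) (x : Lin) : Option Lin :=
  (A.parityOf x).bind fun p => some (x.shift (5 * p))

/-- The symbolic function `F₂` computes the doubled values of `F` on arcs. -/
def Doubles (F₂ : ℤ → Arc → Lin → Option Lin) (F : ℕ → ℕ) : Prop :=
  ∀ {T : ℤ} {A : Arc} {L R : Lin}, F₂ T A L = some R → ∀ {t i : ℤ}, T ≤ t → A.Covers t i →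
    ∀ {x : ℕ}, L.eval t i = x → R.eval t i = 2 * (F x : ℤ)

theorem doubles_lineUU : Doubles lineUU₂ lineUU := by
  intro T A L R h t i ht hi x hx
  obtain ⟨p, hp, h⟩ := Option.bind_eq_some_iff.1 h
  have := min_sound h ht hi
  have := parityOf_sound hp hi
  simp only [Lin.eval_smul, Lin.eval_shift, lineUU] at *
  omega

theorem doubles_lineUV : Doubles lineUV₂ lineUV := by
  intro T A L R h t i ht hi x hx
  obtain ⟨p, hp, h⟩ := Option.bind_eq_some_iff.1 h
  have := parityOf_sound hp hi
  cases h
  simp only [Lin.eval_shift, lineUV]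
  omega

theorem doubles_lineVV : Doubles lineVV₂ lineVV := by
  intro T A L R h t i ht hi x hx
  obtain ⟨p, hp, h⟩ := Option.bind_eq_some_iff.1 h
  have := parityOf_sound hp hi
  cases h
  simp only [Lin.eval_shift, lineVV]
  split_ifs <;> omega

/-- The symbolic version of `around`, at the order `n` given as a linear form. -/
def around₂ (F₂ : ℤ → Arc → Lin → Option Lin) (T : ℤ) (A : Arc) (n x : Lin) : Option Lin :=
  (F₂ T A x).bind fun a => (F₂ T A (n.sub x)).bind fun b => A.min T a b

/-- A representative in the range from `0` to `n` of the class modulo `n` of a linear form, where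
both ends are allowed. -/
def reduce (T : ℤ) (A : Arc) (n x : Lin) : Option Lin :=
  if A.nonneg T (x.sub n) then some (x.sub n)
  else if A.nonneg T (n.sub x) then some x else none

theorem around₂_sound {F₂ : ℤ → Arc → Lin → Option Lin} {F : ℕ → ℕ} (hF : Doubles F₂ F) {T : ℤ}
    {A : Arc} {N L R : Lin} (h : around₂ F₂ T A N L = some R) {t i : ℤ} (ht : T ≤ t)
    (hi : A.Covers t i) {n x : ℕ} (hN : N.eval t i = n) (hx : L.eval t i = x) (hxn : x ≤ n) :
    R.eval t i = 2 * (around F n x : ℤ) := by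
  obtain ⟨a, ha, h⟩ := Option.bind_eq_some_iff.1 h
  obtain ⟨b, hb, h⟩ := Option.bind_eq_some_iff.1 h
  have h1 := hF ha ht hi hx
  have h2 := hF hb ht hi (x := n - x) (by rw [Lin.eval_sub]; omega)
  rw [min_sound h ht hi, h1, h2, around]
  omega

theorem reduce_sound {T : ℤ} {A : Arc} {N L R : Lin} (h : reduce T A N L = some R) {t i : ℤ}
    (ht : T ≤ t) (hi : A.Covers t i) {n x : ℕ} (hN : N.eval t i = n) (hx : L.eval t i = x)
    (hxn : x ≤ 2 * n) : ∃ y : ℕ, R.eval t i = y ∧ y ≤ n ∧ (y = x ∨ y + n = x) := by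
  unfold reduce at h
  split_ifs at h with h1 h2
  · have := nonneg_sound h1 ht hi
    cases h
    rw [Lin.eval_sub] at this ⊢
    exact ⟨x - n, by omega, by omega, by omega⟩
  · have := nonneg_sound h2 ht hi
    cases h
    rw [Lin.eval_sub] at this
    exact ⟨x, hx, by omega, by omega⟩

end Arc

/-- `around` takes the same value at `0` and at `n`, hence depends only on the class modulo `n`. -/
theorem around_congr (F : ℕ → ℕ) {n x y : ℕ} (hx : x ≤ n) (hy : y ≤ n)
    (h : x = y ∨ x = y + n ∨ y = x + n) : around F n x = around F n y := by
  rcases h with rfl | rfl | rfl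
  · rfl
  · obtain rfl : y = 0 := by omega
    simp [around, min_comm]
  · obtain rfl : x = 0 := by omega
    simp [around, min_comm]

namespace Arc

/-- Twice the distance from a vertex to the edges of kind `τ` on an arc, in terms of the distances
`F` and `G` from that vertex to the vertices of the outer and the inner rim. -/
def combine₂ (F₂ G₂ : ℤ → Arc → Lin → Option Lin) (T : ℤ) (A : Arc) (n x : Lin) :
    EdgeKind → Option Lin
  | .rim => (around₂ F₂ T A n x).bind fun a => (reduce T A n (x.shift 1)).bind fun y =>
      (around₂ F₂ T A n y).bind fun b => A.min T a b
  | .spoke => (around₂ F₂ T A n x).bind fun a => (around₂ G₂ T A n x).bind fun b => A.min T a b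
  | .inner => (around₂ G₂ T A n x).bind fun a => (reduce T A n (x.shift 2)).bind fun y =>
      (around₂ G₂ T A n y).bind fun b => A.min T a b

end Arc

/-- The distance to the edge of the given kind at offset `x`, in terms of the distances `F` and `G`
to the vertices of the outer and the inner rim. -/
def combine (F G : ℕ → ℕ) (n : ℕ) : EdgeKind → ℕ → ℕ
  | .rim, x => min (around F n x) (around F n (step n 1 x))
  | .spoke, x => min (around F n x) (around G n x)
  | .inner, x => min (around G n x) (around G n (step n 2 x))

theorem fromU_eq_combine (n : ℕ) (τ : EdgeKind) (x : ℕ) :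
    fromU n τ x = combine lineUU lineUV n τ x := by
  cases τ <;> rfl

theorem fromV_eq_combine (n : ℕ) (τ : EdgeKind) (x : ℕ) :
    fromV n τ x = combine lineUV lineVV n τ x := by
  cases τ <;> rfl

namespace Arc

theorem combine₂_sound {F₂ G₂ : ℤ → Arc → Lin → Option Lin} {F G : ℕ → ℕ} (hF : Doubles F₂ F)
    (hG : Doubles G₂ G) {T : ℤ} {A : Arc} {N L R : Lin} {τ : EdgeKind}
    (h : combine₂ F₂ G₂ T A N L τ = some R) {t i : ℤ} (ht : T ≤ t) (hi : A.Covers t i)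
    {n x y : ℕ} (hn : 2 ≤ n) (hN : N.eval t i = n) (hy : L.eval t i = y) (hyn : y ≤ n) (hx : x < n)
    (hxy : y = x ∨ y = x + n) : R.eval t i = 2 * (combine F G n τ x : ℤ) := by
  have step_case : ∀ {H₂ H}, Doubles H₂ H → ∀ {s : ℕ}, 0 < s → s ≤ 2 → ∀ {K b : Lin},
      reduce T A N (L.shift s) = some K → around₂ H₂ T A N K = some b →
      b.eval t i = 2 * (around H n (step n s x) : ℤ) := by
    intro H₂ H hH s hs hs2 K b hK hb
    obtain ⟨z, hz, hzn, hz'⟩ := reduce_sound hK ht hi hN (x := y + s)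
      (by rw [Lin.eval_shift, hy]; push_cast; ring) (by omega)
    rw [around₂_sound hH hb ht hi hN hz hzn]
    have : step n s x ≤ n := by unfold step; split_ifs <;> omega
    rw [around_congr H hzn this]
    unfold step
    split_ifs <;> omega
  have here : ∀ {H₂ H}, Doubles H₂ H → ∀ {a}, around₂ H₂ T A N L = some a →
      a.eval t i = 2 * (around H n x : ℤ) := by
    intro H₂ H hH a ha
    rw [around₂_sound hH ha ht hi hN hy hyn, around_congr H hyn hx.le (by omega)]
  cases τ
  · obtain ⟨a, ha, h⟩ := Option.bind_eq_some_iff.1 h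
    obtain ⟨K, hK, h⟩ := Option.bind_eq_some_iff.1 h
    obtain ⟨b, hb, h⟩ := Option.bind_eq_some_iff.1 h
    rw [min_sound h ht hi, here hF ha, step_case hF (s := 1) (by omega) (by omega) hK hb]
    simp only [combine]
    omega
  · obtain ⟨a, ha, h⟩ := Option.bind_eq_some_iff.1 h
    obtain ⟨b, hb, h⟩ := Option.bind_eq_some_iff.1 h
    rw [min_sound h ht hi, here hF ha, here hG hb]
    simp only [combine]
    omega
  · obtain ⟨a, ha, h⟩ := Option.bind_eq_some_iff.1 h
    obtain ⟨K, hK, h⟩ := Option.bind_eq_some_iff.1 h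
    obtain ⟨b, hb, h⟩ := Option.bind_eq_some_iff.1 h
    rw [min_sound h ht hi, here hG ha, step_case hG (s := 2) (by omega) (by omega) hK hb]
    simp only [combine]
    omega

/-- Twice the distance in `GP(4 * t + r, 2)` from the vertex with index `a * t + b`, where
`c = (a, b)`, to the edges of kind `τ` on an arc. -/
def edgeDist₂ (F₂ G₂ : ℤ → Arc → Lin → Option Lin) (T r : ℤ) (c : ℤ × ℤ) (τ : EdgeKind) (A : Arc) :
    Option Lin :=
  (reduce T A ⟨0, 4, r⟩ ⟨1, 4 - c.1, r - c.2⟩).bind fun x => combine₂ F₂ G₂ T A ⟨0, 4, r⟩ x τ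

theorem edgeDist₂_sound {F₂ G₂ : ℤ → Arc → Lin → Option Lin} {F G : ℕ → ℕ} (hF : Doubles F₂ F)
    (hG : Doubles G₂ G) {T r : ℤ} {A : Arc} {a b : ℤ} {R : Lin} {τ : EdgeKind}
    (h : edgeDist₂ F₂ G₂ T r (a, b) τ A = some R) {t : ℤ} {n c i : ℕ} (ht : T ≤ t)
    (hn : 2 ≤ n) (hN : (n : ℤ) = 4 * t + r) (hc : (c : ℤ) = a * t + b) (hcn : c < n) (hin : i < n)
    (hi : A.Covers t i) : R.eval t i = 2 * (combine F G n τ (offset n c i) : ℤ) := by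
  obtain ⟨L, hL, h⟩ := Option.bind_eq_some_iff.1 h
  have hN' : Lin.eval ⟨0, 4, r⟩ t i = n := by rw [hN, Lin.eval]; ring
  obtain ⟨y, hy, hyn, hy'⟩ := reduce_sound hL ht hi hN' (x := i + n - c) (by
    rw [Nat.cast_sub (by omega), Nat.cast_add, hN, hc, Lin.eval]; ring) (by omega)
  refine combine₂_sound hF hG h ht hi hn hN' hy hyn ?_ ?_
  · unfold offset
    split_ifs <;> omega
  · unfold offset
    split_ifs <;> omega

end Arc

/-! ### Certificates for edge metric generators -/

/-- A vector of doubled distances from three vertices, as linear forms on an arc. -/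
abbrev Code := Lin × Lin × Lin

/-- The doubled distances from `u_0` and from the inner vertices with indices `c` and `d`. -/
def Arc.code (T r : ℤ) (c d : ℤ × ℤ) (τ : EdgeKind) (A : Arc) : Option Code :=
  (A.edgeDist₂ lineUU₂ lineUV₂ T r (0, 0) τ).bind fun x =>
    (A.edgeDist₂ lineUV₂ lineVV₂ T r c τ).bind fun y =>
      (A.edgeDist₂ lineUV₂ lineVV₂ T r d τ).bind fun z => some (x, y, z)

/-- The three linear forms take the given values. -/
def Code.Vals (K : Code) (t i x y z : ℤ) : Prop :=
  K.1.eval t i = x ∧ K.2.1.eval t i = y ∧ K.2.2.eval t i = z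

/-- The linear combination of the entries of a vector with coefficients `m`. -/
def Code.comb (m : ℤ × ℤ × ℤ) (K : Code) : Lin :=
  ((Lin.smul m.1 K.1).add (Lin.smul m.2.1 K.2.1)).add (Lin.smul m.2.2 K.2.2)

/-- A sufficient test for `L` on `A` and `M` on `B` to have no common value when `T ≤ t`. Either
`L - M` is positive, its smallest value being tested as in `Arc.nonneg`, or, with `i = 2 * i' + p`
and `j = 2 * j' + q`, the equation has no solution modulo the common divisor of the coefficients of
`i'`, `j'` and `t`. -/
def apart (T : ℤ) (A B : Arc) (L M : Lin) : Bool :=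
  let e := if 0 ≤ L.ci then A.first else A.last
  let f := if 0 ≤ M.ci then B.last else B.first
  let α := L.ct - M.ct + L.ci * e.1 - M.ci * f.1
  let β := L.c - M.c + L.ci * e.2 - M.ci * f.2
  (decide (0 ≤ α) && decide (0 < T * α + β)) ||
    !decide ((Int.gcd (Int.gcd (2 * L.ci) (2 * M.ci)) (L.ct - M.ct) : ℤ) ∣
      L.c - M.c + L.ci * A.parity - M.ci * B.parity)

theorem apart_sound {T : ℤ} {A B : Arc} {L M : Lin} (h : apart T A B L M = true) {t i j : ℤ}
    (ht : T ≤ t) (hi : A.Covers t i) (hj : B.Covers t j) : L.eval t i ≠ M.eval t j := by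
  intro heq
  obtain ⟨hi0, hi1, hi2⟩ := hi
  obtain ⟨hj0, hj1, hj2⟩ := hj
  simp only [apart, Bool.or_eq_true, Bool.and_eq_true, decide_eq_true_eq, Bool.not_eq_true',
    decide_eq_false_iff_not] at h
  simp only [Lin.eval] at heq
  rcases h with ⟨h1, h2⟩ | h
  · have hL : L.ci * ((if 0 ≤ L.ci then A.first else A.last).1 * t +
        (if 0 ≤ L.ci then A.first else A.last).2) ≤ L.ci * i := by
      split_ifs with hs
      · exact mul_le_mul_of_nonneg_left hi1 hs
      · exact mul_le_mul_of_nonpos_left hi2 (not_le.1 hs).le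
    have hM : M.ci * j ≤ M.ci * ((if 0 ≤ M.ci then B.last else B.first).1 * t +
        (if 0 ≤ M.ci then B.last else B.first).2) := by
      split_ifs with hs
      · exact mul_le_mul_of_nonneg_left hj2 hs
      · exact mul_le_mul_of_nonpos_left hj1 (not_le.1 hs).le
    generalize (if 0 ≤ L.ci then A.first else A.last) = e at *
    generalize (if 0 ≤ M.ci then B.last else B.first) = f at *
    nlinarith [mul_le_mul_of_nonneg_right ht h1]
  · refine h ?_
    have h1 : L.c - M.c + L.ci * A.parity - M.ci * B.parity =
        -(2 * L.ci * (i / 2)) + 2 * M.ci * (j / 2) - (L.ct - M.ct) * t := by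
      rw [← hi0, ← hj0, Int.emod_def, Int.emod_def]
      linear_combination heq
    have d1 : (Int.gcd (Int.gcd (2 * L.ci) (2 * M.ci)) (L.ct - M.ct) : ℤ) ∣ 2 * L.ci :=
      (Int.gcd_dvd_left ..).trans (Int.gcd_dvd_left ..)
    have d2 : (Int.gcd (Int.gcd (2 * L.ci) (2 * M.ci)) (L.ct - M.ct) : ℤ) ∣ 2 * M.ci :=
      (Int.gcd_dvd_left ..).trans (Int.gcd_dvd_right ..)
    have d3 : (Int.gcd (Int.gcd (2 * L.ci) (2 * M.ci)) (L.ct - M.ct) : ℤ) ∣ L.ct - M.ct :=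
      Int.gcd_dvd_right ..
    rw [h1]
    exact dvd_sub (dvd_add ((d1.mul_right _).neg_right) (d2.mul_right _)) (d3.mul_right _)

/-- The coefficients of the linear combinations that are tried. -/
def multipliers : List (ℤ × ℤ × ℤ) :=
  [0, 1, -1].flatMap fun a => [0, 1, -1].flatMap fun b => [0, 1, -1].map fun c => (a, b, c)

/-- One line of a table of distances: the edges of one kind on an arc, with their codes. -/
abbrev Line := EdgeKind × Arc × Code

/-- The lines of a table for a list of consecutive arcs, each given by its last element; `first` is
the first element of the first arc. -/
def lines (T r : ℤ) (c d : ℤ × ℤ) (τ : EdgeKind) (p : ℤ) : ℤ × ℤ → List (ℤ × ℤ) →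
    Option (List Line)
  | _, [] => some []
  | first, b :: bs => (Arc.code T r c d τ ⟨p, first, b⟩).bind fun K =>
      (lines T r c d τ p (b.1, b.2 + 2) bs).bind fun l => some ((τ, ⟨p, first, b⟩, K) :: l)

/-- The bounds have parity `p`, and the last one is beyond the last index of parity `p`. -/
def exhausts (r p : ℤ) : ℤ × ℤ → List (ℤ × ℤ) → Bool
  | first, [] => decide (first.1 = 4) && decide (r ≤ first.2)
  | _, b :: bs => decide (b.1 % 2 = 0) && decide (b.2 % 2 = p) && exhausts r p (b.1, b.2 + 2) bs

/-- Two lines whose codes are told apart by one of the linear combinations. -/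
def Line.apart (T : ℤ) (x y : Line) : Bool :=
  multipliers.any fun m => GP2.apart T x.2.1 y.2.1 (x.2.2.comb m) (y.2.2.comb m)

/-- A line is injective if one of its three entries is not constant, or if its arc is a point. -/
def Line.injective (x : Line) : Bool :=
  decide (x.2.2.1.ci ≠ 0) || decide (x.2.2.2.1.ci ≠ 0) || decide (x.2.2.2.2.ci ≠ 0) ||
    decide (x.2.1.first = x.2.1.last)

/-- The codes of all lines are pairwise different. -/
def separated (T : ℤ) (l : List Line) : Bool :=
  decide (l.Pairwise fun x y => x.apart T y = true) && l.all Line.injective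

/-- The two lines have no code in common, except for the same edge. -/
def Line.Disjoint (t : ℤ) (x y : Line) : Prop :=
  ∀ i j u v w, x.2.1.Covers t i → y.2.1.Covers t j → x.2.2.Vals t i u v w →
    y.2.2.Vals t j u v w → x.1 = y.1 ∧ i = j

theorem Code.Vals.comb {K : Code} {t i x y z : ℤ} (h : K.Vals t i x y z) (m : ℤ × ℤ × ℤ) :
    (K.comb m).eval t i = m.1 * x + m.2.1 * y + m.2.2 * z := by
  obtain ⟨rfl, rfl, rfl⟩ := h
  simp only [Code.comb, Lin.eval_add, Lin.eval_smul]

theorem Line.disjoint_of_apart {T t : ℤ} (ht : T ≤ t) {x y : Line} (h : x.apart T y = true) :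
    x.Disjoint t y := by
  intro i j u v w hi hj hx hy
  obtain ⟨m, -, hm⟩ := List.any_eq_true.1 h
  exact absurd ((hx.comb m).trans (hy.comb m).symm) (apart_sound hm ht hi hj)

theorem Line.disjoint_self {t : ℤ} {x : Line} (h : x.injective = true) : x.Disjoint t x := by
  intro i j u v w hi hj hx hy
  refine ⟨rfl, ?_⟩
  have cancel : ∀ {L : Lin}, L.ci ≠ 0 → L.eval t i = L.eval t j → i = j := by
    intro L hL h
    exact mul_left_cancel₀ hL (by simpa [Lin.eval] using h)
  simp only [Line.injective, Bool.or_eq_true, decide_eq_true_eq] at h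
  rcases h with ((h | h) | h) | h
  · exact cancel h (hx.1.trans hy.1.symm)
  · exact cancel h (hx.2.1.trans hy.2.1.symm)
  · exact cancel h (hx.2.2.trans hy.2.2.symm)
  · obtain ⟨-, h1, h2⟩ := hi
    obtain ⟨-, h3, h4⟩ := hj
    rw [h] at h1 h3
    omega

theorem separated_sound {T t : ℤ} (ht : T ≤ t) {l : List Line} (h : separated T l = true)
    {x y : Line} (hx : x ∈ l) (hy : y ∈ l) : x.Disjoint t y := by
  simp only [separated, Bool.and_eq_true, decide_eq_true_eq, List.all_eq_true] at h
  have : Std.Symm (Line.Disjoint t) := ⟨fun a b hab i j u v w hi hj ha hb =>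
    (hab j i u v w hj hi hb ha).imp Eq.symm Eq.symm⟩
  exact List.Pairwise.forall_of_forall (fun z hz => Line.disjoint_self (h.2 z hz))
    (h.1.imp fun h => Line.disjoint_of_apart ht h) hx hy

theorem Arc.code_sound {T r : ℤ} {c d : ℤ × ℤ} {τ : EdgeKind} {A : Arc} {K : Code}
    (h : A.code T r c d τ = some K) {t : ℤ} {n a b i : ℕ} (ht : T ≤ t) (hn : 2 ≤ n)
    (hN : (n : ℤ) = 4 * t + r) (hc : (a : ℤ) = c.1 * t + c.2) (hd : (b : ℤ) = d.1 * t + d.2)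
    (ha : a < n) (hb : b < n) (hin : i < n) (hi : A.Covers t i) :
    K.Vals t i (2 * edgeDist n (.inl 0) (τ, i)) (2 * edgeDist n (.inr a) (τ, i))
      (2 * edgeDist n (.inr b) (τ, i)) := by
  obtain ⟨x, hx, h⟩ := Option.bind_eq_some_iff.1 h
  obtain ⟨y, hy, h⟩ := Option.bind_eq_some_iff.1 h
  obtain ⟨z, hz, h⟩ := Option.bind_eq_some_iff.1 h
  cases h
  refine ⟨?_, ?_, ?_⟩
  · rw [edgeDist, fromU_eq_combine]
    exact edgeDist₂_sound doubles_lineUU doubles_lineUV hx ht hn hN (by simp) (by omega) hin hi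
  · rw [edgeDist, fromV_eq_combine]
    exact edgeDist₂_sound doubles_lineUV doubles_lineVV hy ht hn hN hc ha hin hi
  · rw [edgeDist, fromV_eq_combine]
    exact edgeDist₂_sound doubles_lineUV doubles_lineVV hz ht hn hN hd hb hin hi

theorem lines_sound {T r : ℤ} {c d : ℤ × ℤ} {τ : EdgeKind} {p : ℤ} {t : ℤ} {n a b i : ℕ}
    (ht : T ≤ t) (hn : 2 ≤ n)
    (hN : (n : ℤ) = 4 * t + r) (hc : (a : ℤ) = c.1 * t + c.2) (hd : (b : ℤ) = d.1 * t + d.2)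
    (ha : a < n) (hb : b < n) (hin : i < n) (hp : (i : ℤ) % 2 = p) {bs : List (ℤ × ℤ)}
    {first : ℤ × ℤ} (hfirst : first.1 * t + first.2 ≤ i) {l : List Line}
    (hl : lines T r c d τ p first bs = some l) (hex : exhausts r p first bs = true) :
    ∃ x ∈ l, x.1 = τ ∧ x.2.1.Covers t i ∧
      x.2.2.Vals t i (2 * edgeDist n (.inl 0) (τ, i)) (2 * edgeDist n (.inr a) (τ, i))
        (2 * edgeDist n (.inr b) (τ, i)) := by
  induction bs generalizing first l with
  | nil =>
    simp only [exhausts, Bool.and_eq_true, decide_eq_true_eq] at hex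
    rw [hex.1] at hfirst
    omega
  | cons e bs ih =>
    obtain ⟨K, hK, hl⟩ := Option.bind_eq_some_iff.1 hl
    obtain ⟨l', hl', hl⟩ := Option.bind_eq_some_iff.1 hl
    cases hl
    simp only [exhausts, Bool.and_eq_true, decide_eq_true_eq] at hex
    by_cases hi : (i : ℤ) ≤ e.1 * t + e.2
    · exact ⟨_, List.mem_cons_self, rfl, ⟨hp, hfirst, hi⟩,
        Arc.code_sound hK ht hn hN hc hd ha hb hin ⟨hp, hfirst, hi⟩⟩
    · have h2 : e.1 * t % 2 = 0 := by rw [Int.mul_emod, hex.1.1]; simp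
      obtain ⟨x, hx, h⟩ := ih (first := (e.1, e.2 + 2)) (by simp only; omega) hl' hex.2
      exact ⟨x, List.mem_cons_of_mem _ hx, h⟩

/-- A certificate: for each kind of edge and each parity, the last elements of consecutive arcs on
which all distances are linear. -/
structure Certificate where
  rimEven : List (ℤ × ℤ)
  rimOdd : List (ℤ × ℤ)
  spokeEven : List (ℤ × ℤ)
  spokeOdd : List (ℤ × ℤ)
  innerEven : List (ℤ × ℤ)
  innerOdd : List (ℤ × ℤ)

namespace Certificate

/-- The bounds belonging to a kind of edge and a parity. -/
def bounds (C : Certificate) : EdgeKind → ℤ → List (ℤ × ℤ)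
  | .rim, p => if p = 0 then C.rimEven else C.rimOdd
  | .spoke, p => if p = 0 then C.spokeEven else C.spokeOdd
  | .inner, p => if p = 0 then C.innerEven else C.innerOdd

/-- The table of all distances. -/
def table (C : Certificate) (T r : ℤ) (c d : ℤ × ℤ) : List (EdgeKind × ℤ) → Option (List Line)
  | [] => some []
  | (τ, p) :: rest => (lines T r c d τ p (0, p) (C.bounds τ p)).bind fun l =>
      (C.table T r c d rest).bind fun l' => some (l ++ l')

/-- The six combinations of a kind of edge and a parity. -/
def blocks : List (EdgeKind × ℤ) :=
  [(.rim, 0), (.rim, 1), (.spoke, 0), (.spoke, 1), (.inner, 0), (.inner, 1)]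

/-- The certificate shows that `u_0` and the inner vertices with indices `c` and `d` resolve the
edges of `GP(4 * t + r, 2)` for all `t ≥ T`. -/
def valid (C : Certificate) (T r : ℤ) (c d : ℤ × ℤ) : Bool :=
  (blocks.all fun b => exhausts r b.2 (0, b.2) (C.bounds b.1 b.2)) &&
    match C.table T r c d blocks with
    | some l => separated T l
    | none => false

theorem table_lines {C : Certificate} {T r : ℤ} {c d : ℤ × ℤ} {bl : List (EdgeKind × ℤ)}
    {l : List Line} (h : C.table T r c d bl = some l) {τ : EdgeKind} {p : ℤ} (hb : (τ, p) ∈ bl) :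
    ∃ l', lines T r c d τ p (0, p) (C.bounds τ p) = some l' ∧ l' ⊆ l := by
  induction bl generalizing l with
  | nil => simp at hb
  | cons b bl ih =>
    obtain ⟨l₁, h₁, h⟩ := Option.bind_eq_some_iff.1 h
    obtain ⟨l₂, h₂, h⟩ := Option.bind_eq_some_iff.1 h
    cases h
    rcases List.mem_cons.1 hb with rfl | hb
    · exact ⟨l₁, h₁, List.subset_append_left _ _⟩
    · obtain ⟨l', hl', hsub⟩ := ih h₂ hb
      exact ⟨l', hl', fun _ hz => List.subset_append_right _ _ (hsub hz)⟩

theorem resolves {C : Certificate} {T r : ℤ} {c d : ℤ × ℤ} (h : C.valid T r c d = true) {t : ℤ}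
    {n a b : ℕ} (ht : T ≤ t) (hn : 2 ≤ n) (hN : (n : ℤ) = 4 * t + r)
    (hc : (a : ℤ) = c.1 * t + c.2) (hd : (b : ℤ) = d.1 * t + d.2) (ha : a < n) (hb : b < n) :
    ∀ e ∈ edgeNames n, ∀ f ∈ edgeNames n,
      (∀ w ∈ [Sum.inl 0, .inr a, .inr b], edgeDist n w e = edgeDist n w f) → e = f := by
  rintro ⟨τ, i⟩ he ⟨τ', j⟩ hf hw
  rw [mem_edgeNames] at he hf
  simp only [valid, Bool.and_eq_true, List.all_eq_true] at h
  obtain ⟨hex, h⟩ := h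
  cases hl : C.table T r c d blocks with
  | none => simp [hl] at h
  | some l =>
    simp only [hl] at h
    have find : ∀ (τ : EdgeKind) (i : ℕ), i < n → ∃ x ∈ l, x.1 = τ ∧ x.2.1.Covers t i ∧
        x.2.2.Vals t i (2 * edgeDist n (.inl 0) (τ, i)) (2 * edgeDist n (.inr a) (τ, i))
          (2 * edgeDist n (.inr b) (τ, i)) := by
      intro τ i hi
      have hmem : (τ, (i : ℤ) % 2) ∈ blocks := by
        rcases Int.emod_two_eq_zero_or_one i with h | h <;> rw [h] <;> cases τ <;> simp [blocks]
      obtain ⟨l', hl', hsub⟩ := table_lines hl hmem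
      obtain ⟨x, hx, hx'⟩ := lines_sound ht hn hN hc hd ha hb hi rfl
        (by simp only [zero_mul, zero_add]; omega) hl' (hex _ hmem)
      exact ⟨x, hsub hx, hx'⟩
    obtain ⟨x, hx, rfl, hxi, hxv⟩ := find τ i he
    obtain ⟨y, hy, rfl, hyj, hyv⟩ := find τ' j hf
    rw [hw (.inl 0) (by simp), hw (.inr a) (by simp), hw (.inr b) (by simp)] at hxv
    obtain ⟨h1, h2⟩ := separated_sound ht h hx hy _ _ _ _ _ hxi hyj hxv hyv
    exact Prod.ext h1 (by exact_mod_cast h2)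

end Certificate

/-! ### The certificates for the four residues modulo four -/

/-- The arcs for `GP(4 * t, 2)`, valid for `t ≥ 4`. -/
def certificate0 : Certificate where
  rimEven := [(0, 2), (2, -2), (2, 2), (4, -6), (4, -2)]
  rimOdd := [(0, 1), (0, 5), (2, -1), (2, 1), (4, -5), (4, -1)]
  spokeEven := [(0, 2), (2, 0), (2, 2), (4, -4), (4, -2)]
  spokeOdd := [(0, 3), (2, -1), (2, 3), (4, -5), (4, -1)]
  innerEven := [(0, 0), (0, 2), (2, -2), (2, 0), (2, 2), (4, -2)]
  innerOdd := [(0, 1), (2, -3), (2, -1), (2, 1), (4, -3), (4, -1)]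

set_option maxRecDepth 100000 in
theorem certificate0_valid : certificate0.valid 4 0 (0, 3) (2, 3) = true := by
  decide +kernel

/-- The arcs for `GP(4 * t + 1, 2)`, valid for `t ≥ 5`. -/
def certificate1 : Certificate where
  rimEven := [(0, 4), (2, -6), (2, -2), (2, 0), (4, -6), (4, -4), (4, 0)]
  rimOdd := [(0, 3), (2, -7), (2, -5), (2, -1), (4, -7), (4, -5), (4, -1)]
  spokeEven := [(0, 2), (2, -6), (2, 0), (4, -8), (4, -6), (4, -4), (4, -2), (4, 0)]
  spokeOdd := [(0, 3), (2, -5), (2, -1), (4, -7), (4, -5), (4, -3), (4, -1)]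
  innerEven := [(2, -8), (2, -6), (2, -2), (2, 0), (4, -10), (4, -8), (4, -4), (4, -2), (4, 0)]
  innerOdd := [(2, -7), (2, -5), (2, -3), (2, -1), (4, -9), (4, -7), (4, -5), (4, -3), (4, -1)]

set_option maxRecDepth 100000 in
theorem certificate1_valid : certificate1.valid 5 1 (2, -5) (2, -4) = true := by
  decide +kernel

/-- The arcs for `GP(4 * t + 2, 2)`, valid for `t ≥ 4`. -/
def certificate2 : Certificate where
  rimEven := [(0, 4), (2, -2), (2, 0), (4, -4), (4, -2), (4, 0)]
  rimOdd := [(0, 3), (2, -3), (2, -1), (4, -3), (4, -1), (4, 1)]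
  spokeEven := [(0, 2), (2, -2), (2, 0), (4, -2), (4, 0)]
  spokeOdd := [(0, 3), (2, -1), (4, -3), (4, -1), (4, 1)]
  innerEven := [(2, -4), (2, -2), (2, 0), (4, -2), (4, 0)]
  innerOdd := [(2, -3), (2, -1), (4, -3), (4, -1), (4, 1)]

set_option maxRecDepth 100000 in
theorem certificate2_valid : certificate2.valid 4 2 (2, -1) (2, 0) = true := by
  decide +kernel

/-- The arcs for `GP(4 * t + 3, 2)`, valid for `t ≥ 4`. -/
def certificate3 : Certificate where
  rimEven := [(0, 4), (2, -2), (2, 0), (4, -2), (4, 0), (4, 2)]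
  rimOdd := [(0, 3), (2, -3), (2, -1), (4, -3), (4, -1), (4, 1)]
  spokeEven := [(0, 2), (2, -2), (2, 2), (4, -2), (4, 2)]
  spokeOdd := [(0, 3), (2, -1), (4, -1), (4, 1)]
  innerEven := [(2, -4), (2, -2), (2, 0), (4, -4), (4, 0), (4, 2)]
  innerOdd := [(2, -3), (2, -1), (4, -3), (4, 1)]

set_option maxRecDepth 100000 in
theorem certificate3_valid : certificate3.valid 4 3 (2, -1) (2, 0) = true := by
  decide +kernel

/-! ### Small orders -/

/-- All pairs of different edges, in an order in which the index does not decrease. -/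
def edgePairs (n : ℕ) : List ((EdgeKind × ℕ) × (EdgeKind × ℕ)) :=
  (edgeNames n).flatMap fun a =>
    ((edgeNames n).filter fun b => decide (a.2 ≤ b.2) && decide (a ≠ b)).map fun b => (a, b)

/-- The pairs in `P` whose two edges are not resolved by `w`. -/
def unresolved (n : ℕ) (w : ℕ ⊕ ℕ) (P : List ((EdgeKind × ℕ) × (EdgeKind × ℕ))) :
    List ((EdgeKind × ℕ) × (EdgeKind × ℕ)) :=
  P.filter fun p => edgeDist n w p.1 == edgeDist n w p.2

/-- Every three vertices leave a pair of edges unresolved. Filtering the list of pairs by one vertex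
after the other shares the work between triples with a common beginning. -/
def triplesFail (n : ℕ) : Bool :=
  (vertexNames n).all fun w₁ => (vertexNames n).all fun w₂ => (vertexNames n).all fun w₃ =>
    !(unresolved n w₃ (unresolved n w₂ (unresolved n w₁ (edgePairs n)))).isEmpty

theorem four_le_card_of_triplesFail {n : ℕ} (hn : 5 ≤ n) (h : triplesFail n = true)
    {S : Finset (ZMod n ⊕ ZMod n)} (hS : (generalizedPetersen n 2).IsEdgeMetricGenerator S) :
    4 ≤ S.card := by
  classical
  have : NeZero n := ⟨by omega⟩
  by_contra! hcard
  obtain ⟨T, hST, -, hT⟩ := Finset.exists_subsuperset_card_eq (Finset.subset_univ S)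
    (n := 3) (by omega) (by simp [ZMod.card]; omega)
  obtain ⟨x₁, x₂, x₃, -, -, -, rfl⟩ := Finset.card_eq_three.1 hT
  obtain ⟨w₁, h₁, rfl⟩ := exists_vertex x₁
  obtain ⟨w₂, h₂, rfl⟩ := exists_vertex x₂
  obtain ⟨w₃, h₃, rfl⟩ := exists_vertex x₃
  have hgen := (isEdgeMetricGenerator_iff hn (W := [w₁, w₂, w₃]) (by simp [h₁, h₂, h₃])
    (by simp [eq_comm])).1 (hS.mono hST)
  simp only [triplesFail, List.all_eq_true] at h
  obtain ⟨⟨a, b⟩, hp⟩ := List.exists_mem_of_ne_nil _ (by simpa using h w₁ h₁ w₂ h₂ w₃ h₃)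
  simp only [unresolved, List.mem_filter, edgePairs, List.mem_flatMap, List.mem_map, beq_iff_eq,
    Bool.and_eq_true, decide_eq_true_eq, Prod.mk.injEq] at hp
  obtain ⟨⟨⟨⟨a, ha, b, ⟨hb, -, hab⟩, rfl, rfl⟩, e₁⟩, e₂⟩, e₃⟩ := hp
  exact hab (hgen a ha b hb (by simp [e₁, e₂, e₃]))

/-- The vertices in `W` resolve the edges of `GP(n, 2)`. -/
def resolving (n : ℕ) (W : List (ℕ ⊕ ℕ)) : Bool :=
  decide ((edgeNames n).Pairwise fun a b =>
    (W.any fun w => edgeDist n w a != edgeDist n w b) = true)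

theorem resolving_sound {n : ℕ} {W : List (ℕ ⊕ ℕ)} (h : resolving n W = true) :
    ∀ a ∈ edgeNames n, ∀ b ∈ edgeNames n, (∀ w ∈ W, edgeDist n w a = edgeDist n w b) → a = b := by
  intro a ha b hb
  let R : EdgeKind × ℕ → EdgeKind × ℕ → Prop := fun a b =>
    (∀ w ∈ W, edgeDist n w a = edgeDist n w b) → a = b
  have : Std.Symm R := ⟨fun a b hab h => (hab fun w hw => (h w hw).symm).symm⟩
  refine List.Pairwise.forall_of_forall (R := R) (fun _ _ _ => rfl)
    ((of_decide_eq_true h).imp ?_) ha hb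
  intro a b hab hcon
  obtain ⟨w, hw, hne⟩ := List.any_eq_true.1 hab
  exact absurd (hcon w hw) (by simpa using hne)

theorem triplesFail_five : triplesFail 5 = true := by decide +kernel

theorem triplesFail_six : triplesFail 6 = true := by decide +kernel

theorem triplesFail_seven : triplesFail 7 = true := by decide +kernel

theorem triplesFail_nine : triplesFail 9 = true := by decide +kernel

theorem resolving_three :
    resolving 8 [.inl 0, .inr 2, .inr 3] = true ∧ resolving 10 [.inl 0, .inr 3, .inr 4] = true ∧
    resolving 11 [.inl 0, .inr 3, .inr 4] = true ∧ resolving 12 [.inl 0, .inr 3, .inr 4] = true ∧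
    resolving 13 [.inl 0, .inr 3, .inr 4] = true ∧ resolving 14 [.inl 0, .inr 5, .inr 6] = true ∧
    resolving 15 [.inl 0, .inr 5, .inr 6] = true ∧
    resolving 17 [.inl 0, .inr 3, .inr 4] = true := by
  decide +kernel

theorem resolving_four :
    resolving 5 [.inl 0, .inr 0, .inr 1, .inr 4] = true ∧
    resolving 6 [.inl 0, .inr 2, .inr 3, .inr 5] = true ∧
    resolving 7 [.inl 0, .inr 0, .inr 1, .inr 4] = true ∧
    resolving 9 [.inl 0, .inr 0, .inr 1, .inr 6] = true := by
  decide +kernel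

/-! ### The edge metric dimension -/

theorem isEdgeMetricBasis_of_resolves {n a b : ℕ} (hn : 5 ≤ n) (ha : a < n) (hb : b < n)
    (h : ∀ e ∈ edgeNames n, ∀ f ∈ edgeNames n,
      (∀ w ∈ [Sum.inl 0, .inr a, .inr b], edgeDist n w e = edgeDist n w f) → e = f) :
    (generalizedPetersen n 2).IsEdgeMetricBasis
        {Sum.inl 0, Sum.inr (a : ZMod n), Sum.inr (b : ZMod n)} ∧
      (generalizedPetersen n 2).edgeMetricDim = 3 := by
  have hgen : (generalizedPetersen n 2).IsEdgeMetricGenerator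
      {Sum.inl 0, Sum.inr (a : ZMod n), Sum.inr (b : ZMod n)} := by
    refine (isEdgeMetricGenerator_iff hn (W := [.inl 0, .inr a, .inr b]) ?_ ?_).2 h
    · simp [vertexNames, ha, hb]
      omega
    · simp [vertex, eq_comm]
  have hdim := hgen.card_eq_edgeMetricDim fun T hT =>
    Finset.card_le_three.trans (three_le_card hn hT)
  exact ⟨⟨hgen, hdim⟩, hdim ▸ le_antisymm Finset.card_le_three (three_le_card hn hgen)⟩

theorem edgeMetricDim_eq_four {n : ℕ} (hn : 5 ≤ n) {W : List (ℕ ⊕ ℕ)}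
    (hW : ∀ w ∈ W, w ∈ vertexNames n) (hlen : W.length = 4) (h : resolving n W = true)
    (h' : triplesFail n = true) : (generalizedPetersen n 2).edgeMetricDim = 4 := by
  classical
  have hgen : (generalizedPetersen n 2).IsEdgeMetricGenerator (W.map (vertex n)).toFinset :=
    (isEdgeMetricGenerator_iff hn hW (by simp)).2 (resolving_sound h)
  have hcard : (W.map (vertex n)).toFinset.card ≤ 4 := by
    simpa [hlen] using List.toFinset_card_le (W.map (vertex n))
  rw [← hgen.card_eq_edgeMetricDim fun T hT => hcard.trans (four_le_card_of_triplesFail hn h' hT)]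
  exact le_antisymm hcard (four_le_card_of_triplesFail hn h' hgen)

/-- The conclusion drawn from a valid certificate. -/
theorem isEdgeMetricBasis_of_certificate {C : Certificate} {T r : ℕ} {c d : ℤ × ℤ}
    (h : C.valid T r c d = true) {t a b : ℕ} (hT : T ≤ t) (ht : 2 ≤ t)
    (ha : a < 4 * t + r) (hb : b < 4 * t + r)
    (hc : (a : ℤ) = c.1 * t + c.2) (hd : (b : ℤ) = d.1 * t + d.2) :
    (generalizedPetersen (4 * t + r) 2).IsEdgeMetricBasis
        {Sum.inl 0, Sum.inr (a : ZMod (4 * t + r)), Sum.inr (b : ZMod (4 * t + r))} ∧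
      (generalizedPetersen (4 * t + r) 2).edgeMetricDim = 3 :=
  isEdgeMetricBasis_of_resolves (by omega) ha hb
    (Certificate.resolves h (t := t) (by omega) (by omega) (by push_cast; ring) hc hd ha hb)

theorem basis_mod_zero {t : ℕ} (ht : 4 ≤ t) :
    (generalizedPetersen (4 * t) 2).IsEdgeMetricBasis
        {Sum.inl 0, Sum.inr ((3 : ℕ) : ZMod (4 * t)),
          Sum.inr ((2 * t + 3 : ℕ) : ZMod (4 * t))} ∧
      (generalizedPetersen (4 * t) 2).edgeMetricDim = 3 :=
  isEdgeMetricBasis_of_certificate (r := 0) certificate0_valid ht (by omega) (by omega) (by omega)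
    (by simp) (by simp)

theorem basis_mod_one {t : ℕ} (ht : 4 ≤ t) :
    (generalizedPetersen (4 * t + 1) 2).IsEdgeMetricBasis
        {Sum.inl 0, Sum.inr ((2 * t - 5 : ℕ) : ZMod (4 * t + 1)),
          Sum.inr ((2 * t - 4 : ℕ) : ZMod (4 * t + 1))} ∧
      (generalizedPetersen (4 * t + 1) 2).edgeMetricDim = 3 := by
  rcases ht.eq_or_lt with rfl | ht'
  -- The distances from `u_0` to the outer rim change their slope up to the index `5`, so that
  -- the certificate needs `5 ≤ 2 * t - 5`; the case `t = 4` is checked separately.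
  · exact isEdgeMetricBasis_of_resolves (by norm_num) (by norm_num) (by norm_num)
      (resolving_sound resolving_three.2.2.2.2.2.2.2)
  · exact isEdgeMetricBasis_of_certificate certificate1_valid ht' (by omega) (by omega) (by omega)
      (by simp only; omega) (by simp only; omega)

theorem basis_mod_two {t : ℕ} (ht : 4 ≤ t) :
    (generalizedPetersen (4 * t + 2) 2).IsEdgeMetricBasis
        {Sum.inl 0, Sum.inr ((2 * t - 1 : ℕ) : ZMod (4 * t + 2)),
          Sum.inr ((2 * t : ℕ) : ZMod (4 * t + 2))} ∧
      (generalizedPetersen (4 * t + 2) 2).edgeMetricDim = 3 :=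
  isEdgeMetricBasis_of_certificate certificate2_valid ht (by omega) (by omega) (by omega)
    (by simp only; omega) (by simp only; omega)

theorem basis_mod_three {t : ℕ} (ht : 4 ≤ t) :
    (generalizedPetersen (4 * t + 3) 2).IsEdgeMetricBasis
        {Sum.inl 0, Sum.inr ((2 * t - 1 : ℕ) : ZMod (4 * t + 3)),
          Sum.inr ((2 * t : ℕ) : ZMod (4 * t + 3))} ∧
      (generalizedPetersen (4 * t + 3) 2).edgeMetricDim = 3 :=
  isEdgeMetricBasis_of_certificate certificate3_valid ht (by omega) (by omega) (by omega)
    (by simp only; omega) (by simp only; omega)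

theorem edgeMetricDim_eq_three {n : ℕ} (hn : n = 8 ∨ 10 ≤ n) :
    (generalizedPetersen n 2).edgeMetricDim = 3 := by
  have small : ∀ {n a b : ℕ}, 5 ≤ n → a < n → b < n → resolving n [.inl 0, .inr a, .inr b] = true →
      (generalizedPetersen n 2).edgeMetricDim = 3 := fun hn ha hb h =>
    (isEdgeMetricBasis_of_resolves hn ha hb (resolving_sound h)).2
  obtain ⟨h8, h10, h11, h12, h13, h14, h15, -⟩ := resolving_three
  by_cases h16 : 16 ≤ n
  · obtain ⟨t, ht, rfl | rfl | rfl | rfl⟩ : ∃ t, 4 ≤ t ∧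
        (n = 4 * t ∨ n = 4 * t + 1 ∨ n = 4 * t + 2 ∨ n = 4 * t + 3) :=
      ⟨n / 4, by omega, by omega⟩
    exacts [(basis_mod_zero ht).2, (basis_mod_one ht).2, (basis_mod_two ht).2,
      (basis_mod_three ht).2]
  · obtain rfl | rfl | rfl | rfl | rfl | rfl | rfl :
        n = 8 ∨ n = 10 ∨ n = 11 ∨ n = 12 ∨ n = 13 ∨ n = 14 ∨ n = 15 := by omega
    exacts [small (by norm_num) (by norm_num) (by norm_num) h8,
      small (by norm_num) (by norm_num) (by norm_num) h10,
      small (by norm_num) (by norm_num) (by norm_num) h11,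
      small (by norm_num) (by norm_num) (by norm_num) h12,
      small (by norm_num) (by norm_num) (by norm_num) h13,
      small (by norm_num) (by norm_num) (by norm_num) h14,
      small (by norm_num) (by norm_num) (by norm_num) h15]

end GP2

theorem mainTheorem4 :
    (∀ n : ℕ, (n = 8 ∨ 10 ≤ n) → (generalizedPetersen n 2).edgeMetricDim = 3) ∧
    (∀ n : ℕ, (n = 5 ∨ n = 6 ∨ n = 7 ∨ n = 9) → (generalizedPetersen n 2).edgeMetricDim = 4) ∧
    (∀ t : ℕ, 4 ≤ t →
      (generalizedPetersen (4 * t) 2).IsEdgeMetricBasis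
        {Sum.inl 0, Sum.inr ((3 : ℕ) : ZMod (4 * t)),
          Sum.inr ((2 * t + 3 : ℕ) : ZMod (4 * t))} ∧
      (generalizedPetersen (4 * t + 1) 2).IsEdgeMetricBasis
        {Sum.inl 0, Sum.inr ((2 * t - 5 : ℕ) : ZMod (4 * t + 1)),
          Sum.inr ((2 * t - 4 : ℕ) : ZMod (4 * t + 1))} ∧
      (generalizedPetersen (4 * t + 2) 2).IsEdgeMetricBasis
        {Sum.inl 0, Sum.inr ((2 * t - 1 : ℕ) : ZMod (4 * t + 2)),
          Sum.inr ((2 * t : ℕ) : ZMod (4 * t + 2))} ∧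
      (generalizedPetersen (4 * t + 3) 2).IsEdgeMetricBasis
        {Sum.inl 0, Sum.inr ((2 * t - 1 : ℕ) : ZMod (4 * t + 3)),
          Sum.inr ((2 * t : ℕ) : ZMod (4 * t + 3))}) := by
  refine ⟨fun n hn => GP2.edgeMetricDim_eq_three hn, ?_, fun t ht => ⟨(GP2.basis_mod_zero ht).1,
    (GP2.basis_mod_one ht).1, (GP2.basis_mod_two ht).1, (GP2.basis_mod_three ht).1⟩⟩
  obtain ⟨h5, h6, h7, h9⟩ := GP2.resolving_four
  rintro n (rfl | rfl | rfl | rfl)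
  · exact GP2.edgeMetricDim_eq_four (by norm_num) (by simp [GP2.vertexNames]) rfl
      h5 GP2.triplesFail_five
  · exact GP2.edgeMetricDim_eq_four (by norm_num) (by simp [GP2.vertexNames]) rfl
      h6 GP2.triplesFail_six
  · exact GP2.edgeMetricDim_eq_four (by norm_num) (by simp [GP2.vertexNames]) rfl
      h7 GP2.triplesFail_seven
  · exact GP2.edgeMetricDim_eq_four (by norm_num) (by simp [GP2.vertexNames]) rfl
      h9 GP2.triplesFail_nine
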